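/- Let $W$ be the transition matrix of a discrete memoryless channel with finite input alphabet $\mathcal X$, finite output alphabet $\mathcal Y$, all $W(y|x)>0$, and $\lambda=\min_{x,y}W(y|x)$. Write $W_x=W(\cdot|x)$ and $Q_P(y)=\sum_x P(x)W(y|x)$ for a distribution $P$ on $\mathcal X$; logarithms are natural, $D(\cdot\|\cdot)$ is the Kullback–Leibler divergence, $I(P,W)=\sum_{x,y}P(x)W(y|x)\ln\frac{W(y|x)}{Q_P(y)}$, $C=\max_P I(P,W)$, $D=\max_{x,\tilde x}D(W_x\|W_{\tilde x})$, and for $r\le C$ $$J(r)=\max\{\alpha D(Q_{P_1}\|W_{x_1})+(1-\alpha)D(Q_{P_2}\|W_{x_2}) : 0\le\alpha\le1,\ x_1,x_2\in\mathcal X,\ P_1,P_2 \text{ distributions on } \mathcal X,\ \alpha I(P_1,W)+(1-\alpha)I(P_2,W)\ge r\}.$$ Assume $C>0$ (so that $D>0$). A length-$n$ block code with erasures (with noiseless feedback) consists of a message set $\mathcal M=\{1,\dots,|\mathcal M|\}$ with $|\mathcal M|\ge 1$, an encoder that chooses the input letter at each time $t\in\{1,\dots,n\}$ as a function of the message and of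 the previous outputs $y_1,\dots,y_{t-1}$, and a decoder that maps $(y_1,\dots,y_n)$ to a decoded message $\hat m\in\mathcal M\cup\{\mathbf x\}$, where $\mathbf x$ is the erasure symbol. Its conditional error and erasure probabilities are $P_e(m)=\Pr[\hat m\notin\{m,\mathbf x\}\mid m]$ and $P_{\mathbf x}(m)=\Pr[\hat m=\mathbf x\mid m]$. Put $$\epsilon_n=\frac{10\,|\mathcal X|\,|\mathcal Y|\,\ln(e/\lambda)\,\sqrt{\ln(1+n)}}{\sqrt n}.$$ Then for every $n\ge1$, every $0\le R\le C$ and every $0\le E\le(1-\frac RC)D$ there is a length-$n$ block code with erasures such that $$|\mathcal M|\ge e^{n(R-\epsilon_n)},\qquad P_e(1)\le e^{-n\left(E+(1-\frac ED)J\left(\frac{R}{1-E/D}\right)-\epsilon_n\right)},$$ $$P_e(m)\le\epsilon_n\min\{1,e^{-n(E-\epsilon_n)}\}\quad\text{for } m=2,\dots,|\mathcal M|,$$ $$P_{\mathbf x}(m)\le\epsilon_n+e^{-n\left((1-\frac ED)J\left(\frac{R}{1-E/D}\right)-\epsilon_n\right)}\quad\text{for } m=1,\dots,|\mathcal M|,$$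 where $(1-\frac ED)J\left(\frac R{1-E/D}\right)$ is read as $0$ when $R=0$ and $E=D$. -/

import Mathlib

namespace UEP

noncomputable section

/-- Kullback--Leibler divergence (in nats) of two distributions on a finite alphabet,
`∑ y, P y * ln (P y / Q y)`, with `0 * ln 0 = 0`. It is only used where `Q` is positive. -/
def klDiv {Y : Type*} [Fintype Y] (P Q : Y → ℝ) : ℝ :=
  ∑ y, P y * Real.log (P y / Q y)

/-- Output distribution of the channel `W` under the input distribution `P`. -/
def outDist {X Y : Type*} [Fintype X] (P : X → ℝ) (W : X → Y → ℝ) : Y → ℝ :=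
  fun y => ∑ x, P x * W x y

/-- Mutual information `I(P, W)` (in nats). -/
def mutualInfo {X Y : Type*} [Fintype X] [Fintype Y] (P : X → ℝ) (W : X → Y → ℝ) : ℝ :=
  ∑ x, ∑ y, P x * W x y * Real.log (W x y / outDist P W y)

/-- Capacity: the maximum of the mutual information over all input distributions. -/
def capacity {X Y : Type*} [Fintype X] [Fintype Y] (W : X → Y → ℝ) : ℝ :=
  sSup ((fun P => mutualInfo P W) '' stdSimplex ℝ X)

/-- The largest divergence between the output distributions of two input letters. -/
def maxDiv {X Y : Type*} [Fintype Y] (W : X → Y → ℝ) : ℝ :=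
  ⨆ p : X × X, klDiv (W p.1) (W p.2)

/-- The smallest transition probability. -/
def minTrans {X Y : Type*} (W : X → Y → ℝ) : ℝ :=
  ⨅ p : X × Y, W p.1 p.2

/-- The function `J`: the maximum of `α D(Q₁ ‖ W_{x₁}) + (1 - α) D(Q₂ ‖ W_{x₂})` over
time sharing constants `α`, input letters `x₁, x₂` and input distributions `P₁, P₂`
(with output distributions `Q₁, Q₂`) such that `r ≤ α I(P₁, W) + (1 - α) I(P₂, W)`. -/
def J {X Y : Type*} [Fintype X] [Fintype Y] (W : X → Y → ℝ) (r : ℝ) : ℝ :=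
  sSup {v : ℝ | ∃ α ∈ Set.Icc (0 : ℝ) 1, ∃ x₁ x₂ : X,
    ∃ P₁ ∈ stdSimplex ℝ X, ∃ P₂ ∈ stdSimplex ℝ X,
      r ≤ α * mutualInfo P₁ W + (1 - α) * mutualInfo P₂ W ∧
      v = α * klDiv (outDist P₁ W) (W x₁) + (1 - α) * klDiv (outDist P₂ W) (W x₂)}

/-- The error term `10 |X| |Y| ln (e / lam) √(ln (1 + n)) / √n`, where `lam` is the smallest
transition probability. -/
def epsTerm {X Y : Type*} [Fintype X] [Fintype Y] (W : X → Y → ℝ) (n : ℕ) : ℝ :=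
  10 * (Fintype.card X : ℝ) * (Fintype.card Y : ℝ) * Real.log (Real.exp 1 / minTrans W) *
    Real.sqrt (Real.log (1 + (n : ℝ))) / Real.sqrt (n : ℝ)

/-- A length `n` block code with erasures and message set `Fin M`, used with noiseless
feedback: the input letter at time `t` is a function of the message and of the outputs at the
earlier times. The decoder outputs a message, or `none`, the erasure symbol. -/
structure ErasureCode (X Y : Type*) (n M : ℕ) where
  /-- encoding scheme -/
  enc : Fin M → (t : Fin n) → (Fin (t : ℕ) → Y) → X
  /-- decoding rule -/
  dec : (Fin n → Y) → Option (Fin M)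

namespace ErasureCode

variable {X Y : Type*} {n M : ℕ}

/-- Conditional probability of the output sequence `y` given the message `m` when the code is
used on the memoryless stationary channel `W`. -/
def outProb (c : ErasureCode X Y n M) (W : X → Y → ℝ) (m : Fin M) (y : Fin n → Y) : ℝ :=
  ∏ t : Fin n, W (c.enc m t (fun i => y (Fin.castLE t.isLt.le i))) (y t)

/-- Conditional error probability of the message `m`: the decoder outputs a message different
from `m` (an erasure is not an error). -/
def errProb [Fintype Y] (c : ErasureCode X Y n M) (W : X → Y → ℝ) (m : Fin M) : ℝ :=
  ∑ y : Fin n → Y, if c.dec y ≠ some m ∧ c.dec y ≠ none then c.outProb W m y else 0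

/-- Conditional erasure probability of the message `m`. -/
def erasureProb [Fintype Y] (c : ErasureCode X Y n M) (W : X → Y → ℝ) (m : Fin M) : ℝ :=
  ∑ y : Fin n → Y, if c.dec y = none then c.outProb W m y else 0

end ErasureCode

end

end UEP

-- The block is split in two. A fraction `η = 1 - E/D` carries the message. In the rest, the
-- encoder, knowing the tentative decision through feedback, repeats one of two letters `xa`, `xr`
-- with `D(W_xa ‖ W_xr) = D` to confirm or reject it. A likelihood ratio test accepts under `xr`
-- with probability about `exp (-n(1-η)D) = exp (-nE)`. An error needs a wrong tentative decision
-- and a false acceptance; an erasure needs a wrong tentative decision or a false rejection.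
--
-- In the first phase, input distributions are time-shared so as to nearly attain `J(R/η)`, and the
-- special message is sent by the matching word of letters `x₁`, `x₂`. `feinstein` selects ordinary
-- codewords whose decoding regions lie where both the information density and the log-likelihood
-- ratio against the special word are large; every other output goes to the special message. By
-- `sum_llr_le` the special word leaves its region with probability about `exp (-nηJ)`, and by
-- `chernoff_lower` the restriction costs ordinary messages little. `exists_erasureCode` assembles
-- the phases.

namespace UEP

section

open Finset

-- Concentration and change of measure for product distributions.

/-- Chernoff bound for the lower tail of a sum of independent bounded functions under a product
distribution on a finite alphabet. -/
theorem chernoff_lower {ι Z : Type*} [Fintype ι] [DecidableEq ι] [Fintype Z]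
    (p f : ι → Z → ℝ) (hp0 : ∀ t z, 0 ≤ p t z) (hp1 : ∀ t, ∑ z, p t z = 1)
    {K θ u : ℝ} (hf : ∀ t z, |f t z| ≤ K) (hθ : 0 ≤ θ) (hθK : θ * (2 * K) ≤ 1) :
    ∑ z : ι → Z, (if ∑ t, f t (z t) < ∑ t, ∑ a, p t a * f t a - u then ∏ t, p t (z t) else 0)
      ≤ Real.exp (-(θ * u) + Fintype.card ι * (θ * (2 * K)) ^ 2) := by
  classical
  obtain ⟨μ, hμ⟩ : ∃ μ : ι → ℝ, ∀ t, ∑ a, p t a * f t a = μ t := ⟨_, fun _ => rfl⟩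
  simp_rw [hμ]
  have hμK : ∀ t, |μ t| ≤ K := by
    intro t
    calc |μ t| ≤ ∑ a, |p t a * f t a| := hμ t ▸ abs_sum_le_sum_abs _ _
      _ ≤ ∑ a, p t a * K := by
        refine sum_le_sum fun a _ => ?_
        rw [abs_mul, abs_of_nonneg (hp0 t a)]
        exact mul_le_mul_of_nonneg_left (hf t a) (hp0 t a)
      _ = K := by rw [← sum_mul, hp1, one_mul]
  have hmgf : ∀ t, ∑ a, p t a * Real.exp (θ * (μ t - f t a)) ≤
      Real.exp ((θ * (2 * K)) ^ 2) := by
    intro t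
    -- `exp x ≤ 1 + x + x²` for `|x| ≤ 1`; the linear term is centred and vanishes in the mean.
    have hb : ∀ a, Real.exp (θ * (μ t - f t a)) ≤
        1 + θ * (μ t - f t a) + (θ * (2 * K)) ^ 2 := by
      intro a
      have h1 : |θ * (μ t - f t a)| ≤ θ * (2 * K) := by
        rw [abs_mul, abs_of_nonneg hθ]
        refine mul_le_mul_of_nonneg_left ?_ hθ
        have := abs_sub (μ t) (f t a)
        linarith [hμK t, hf t a]
      have h2 := Real.abs_exp_sub_one_sub_id_le (h1.trans hθK)
      have h3 : (θ * (μ t - f t a)) ^ 2 ≤ (θ * (2 * K)) ^ 2 := by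
        rw [← sq_abs]
        exact pow_le_pow_left₀ (abs_nonneg _) h1 2
      linarith [le_abs_self (Real.exp (θ * (μ t - f t a)) - 1 - θ * (μ t - f t a))]
    calc ∑ a, p t a * Real.exp (θ * (μ t - f t a))
        ≤ ∑ a, p t a * (1 + θ * (μ t - f t a) + (θ * (2 * K)) ^ 2) :=
          sum_le_sum fun a _ => mul_le_mul_of_nonneg_left (hb a) (hp0 t a)
      _ = (1 + θ * μ t + (θ * (2 * K)) ^ 2) * (∑ a, p t a) - θ * ∑ a, p t a * f t a := by
          rw [mul_sum, mul_sum, ← sum_sub_distrib]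
          exact sum_congr rfl fun a _ => by ring
      _ = (θ * (2 * K)) ^ 2 + 1 := by rw [hp1, hμ]; ring
      _ ≤ _ := Real.add_one_le_exp _
  -- Markov: on the event the exponential weight is at least 1, and the weighted sum factors over
  -- coordinates.
  calc ∑ z : ι → Z, (if ∑ t, f t (z t) < ∑ t, μ t - u then ∏ t, p t (z t) else 0)
      ≤ ∑ z : ι → Z, Real.exp (-(θ * u)) * ∏ t, (p t (z t) * Real.exp (θ * (μ t - f t (z t)))) := by
        refine sum_le_sum fun z _ => ?_
        have hP : 0 ≤ ∏ t, p t (z t) := prod_nonneg fun t _ => hp0 t _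
        rw [prod_mul_distrib, ← Real.exp_sum, ← mul_sum, sum_sub_distrib, mul_left_comm,
          ← Real.exp_add]
        split_ifs with h
        · refine le_mul_of_one_le_right hP (Real.one_le_exp ?_)
          nlinarith
        · positivity
    _ = Real.exp (-(θ * u)) * ∏ t, ∑ a, p t a * Real.exp (θ * (μ t - f t a)) := by
        rw [← mul_sum, prod_univ_sum, Fintype.piFinset_univ]
    _ ≤ Real.exp (-(θ * u)) * ∏ _t : ι, Real.exp ((θ * (2 * K)) ^ 2) := by
        refine mul_le_mul_of_nonneg_left (prod_le_prod (fun t _ => ?_) fun t _ => hmgf t)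
          (Real.exp_pos _).le
        exact sum_nonneg fun a _ => mul_nonneg (hp0 t a) (Real.exp_pos _).le
    _ = _ := by
        rw [prod_const, ← Real.exp_nat_mul, ← Real.exp_add, card_univ]

/-- Change of measure: the `P`-probability that the log-likelihood ratio of the product
distributions `Q` and `P` is at least `τ` is at most `exp (-τ)`. -/
theorem sum_llr_le {ι Z : Type*} [Fintype ι] [DecidableEq ι] [Fintype Z]
    (P Q : ι → Z → ℝ) (hP : ∀ t z, 0 < P t z) (hQ : ∀ t z, 0 < Q t z) (hQ1 : ∀ t, ∑ z, Q t z = 1)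
    (τ : ℝ) :
    ∑ z : ι → Z, (if τ ≤ ∑ t, Real.log (Q t (z t) / P t (z t)) then ∏ t, P t (z t) else 0)
      ≤ Real.exp (-τ) := by
  calc _ ≤ ∑ z : ι → Z, Real.exp (-τ) * ∏ t, Q t (z t) := by
        refine sum_le_sum fun z _ => ?_
        have hPz : 0 < ∏ t, P t (z t) := prod_pos fun t _ => hP t _
        have hQz : 0 < ∏ t, Q t (z t) := prod_pos fun t _ => hQ t _
        split_ifs with h
        -- On the event, `P ≤ exp (-τ) * Q` pointwise.
        · rw [← Real.log_prod (fun t _ => (div_pos (hQ t _) (hP t _)).ne'), prod_div_distrib,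
            Real.le_log_iff_exp_le (by positivity), le_div_iff₀ hPz] at h
          calc ∏ t, P t (z t) = Real.exp (-τ) * (Real.exp τ * ∏ t, P t (z t)) := by
                rw [← mul_assoc, ← Real.exp_add]; simp
            _ ≤ _ := mul_le_mul_of_nonneg_left h (Real.exp_pos _).le
        · positivity
    _ = Real.exp (-τ) := by
        rw [← mul_sum]
        have := (prod_univ_sum (fun _ : ι => (univ : Finset Z)) Q).symm
        rw [Fintype.piFinset_univ] at this
        rw [this]; simp [hQ1]

-- Feinstein's lemma.

/-- Feinstein's maximal coding lemma, with decoding regions inside a prescribed set `G`. -/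
theorem feinstein {A B : Type*} [Fintype A] [Fintype B] (q : A → ℝ) (V : A → B → ℝ)
    (hq0 : ∀ a, 0 ≤ q a) (hq1 : ∑ a, q a = 1) (hV0 : ∀ a b, 0 ≤ V a b)
    (G : A → B → Prop) [∀ a b, Decidable (G a b)] {κ γ e : ℝ} (hκ : 0 ≤ κ)
    (hG : ∀ a, ∑ b, (if G a b then ∑ a', q a' * V a' b else 0) ≤ κ)
    (hGc : ∑ a, q a * ∑ b, (if G a b then 0 else V a b) ≤ γ)
    (N : ℕ) (hN : N * κ + γ ≤ e) :
    ∃ (cw : Fin N → A) (d : B → Option (Fin N)),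
      (∀ b i, d b = some i → G (cw i) b) ∧
      ∀ i, ∑ b, (if d b = some i then 0 else V (cw i) b) ≤ e := by
  classical
  induction N with
  | zero => exact ⟨Fin.elim0, fun _ => none, fun _ i => i.elim0, fun i => i.elim0⟩
  | succ N ih =>
    push_cast at hN
    obtain ⟨cw, d, hd, he⟩ := ih (by linarith)
    -- The outputs already claimed have mass at most `N * κ` under the output law, since each region
    -- lies in the `G`-slice of its codeword.
    have hU : ∑ b, (if d b = none then 0 else ∑ a, q a * V a b) ≤ N * κ := by
      calc ∑ b, (if d b = none then 0 else ∑ a, q a * V a b)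
          ≤ ∑ b, ∑ i, (if G (cw i) b then ∑ a', q a' * V a' b else 0) := by
            refine sum_le_sum fun b _ => ?_
            have hnn : 0 ≤ ∑ a, q a * V a b :=
              sum_nonneg fun a _ => mul_nonneg (hq0 a) (hV0 a b)
            have hnn' : ∀ i ∈ (univ : Finset (Fin N)),
                0 ≤ (if G (cw i) b then ∑ a', q a' * V a' b else 0) := by
              intro i _; split_ifs <;> first | exact hnn | exact le_rfl
            rcases hdb : d b with _ | i
            · simpa using sum_nonneg hnn'
            · have := single_le_sum hnn' (mem_univ i)
              rw [if_pos (hd b i hdb)] at this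
              simpa using this
        _ = ∑ i, ∑ b, (if G (cw i) b then ∑ a', q a' * V a' b else 0) := sum_comm
        _ ≤ ∑ _i : Fin N, κ := sum_le_sum fun i _ => hG (cw i)
        _ = N * κ := by simp
    -- Random choice: averaged over `q`, missing `G` or hitting a claimed output has probability at
    -- most `γ + N * κ ≤ e`.
    have hex : ∃ a, ∑ b, (if G a b ∧ d b = none then 0 else V a b) ≤ e := by
      by_contra! hcon
      have h1 : ∑ a, q a * ∑ b, (if G a b ∧ d b = none then 0 else V a b) ≤ γ + N * κ := by
        calc ∑ a, q a * ∑ b, (if G a b ∧ d b = none then 0 else V a b)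
            ≤ ∑ a, q a * ∑ b, ((if G a b then 0 else V a b) +
                (if d b = none then 0 else V a b)) := by
              refine sum_le_sum fun a _ => mul_le_mul_of_nonneg_left
                (sum_le_sum fun b _ => ?_) (hq0 a)
              have := hV0 a b
              by_cases h1 : G a b <;> by_cases h2 : d b = none <;> simp [h1, h2, this]
          _ = ∑ a, q a * ∑ b, (if G a b then 0 else V a b) +
                ∑ b, (if d b = none then 0 else ∑ a, q a * V a b) := by
              simp_rw [sum_add_distrib, mul_add, sum_add_distrib, mul_sum]
              congr 1
              rw [sum_comm]
              refine sum_congr rfl fun b _ => ?_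
              split_ifs <;> simp
          _ ≤ _ := add_le_add hGc hU
      have h2 : e < ∑ a, q a * ∑ b, (if G a b ∧ d b = none then 0 else V a b) := by
        calc e = ∑ a, q a * e := by rw [← sum_mul, hq1, one_mul]
          _ < _ := by
            refine sum_lt_sum (fun a _ => mul_le_mul_of_nonneg_left (hcon a).le (hq0 a)) ?_
            by_contra! hz
            have : ∀ a, q a = 0 := by
              intro a
              rcases (hq0 a).eq_or_lt with h | h
              · exact h.symm
              · exact absurd (hz a (mem_univ a)) (not_le.2 (mul_lt_mul_of_pos_left (hcon a) h))
            simp [this] at hq1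
      linarith
    obtain ⟨a, ha⟩ := hex
    -- The new codeword receives the part of its `G`-slice not yet claimed.
    refine ⟨Fin.snoc cw a, fun b => if d b = none then
      (if G a b then some (Fin.last N) else none) else (d b).map Fin.castSucc, ?_, ?_⟩
    · intro b i h
      rcases hdb : d b with _ | j
      · simp only [hdb, if_true] at h
        split_ifs at h with hg
        obtain rfl := Option.some.inj h
        simpa using hg
      · simp only [hdb, reduceCtorEq, if_false, Option.map_some] at h
        obtain rfl := Option.some.inj h
        simpa using hd b j hdb
    · intro i
      refine Fin.lastCases ?_ (fun j => ?_) i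
      · refine le_trans (sum_le_sum fun b _ => ?_) ha
        simp only [Fin.snoc_last]
        rcases hdb : d b with _ | j
        · by_cases hg : G a b <;> simp [hg]
        · have : j.castSucc ≠ Fin.last N := (Fin.castSucc_lt_last j).ne
          simp [this]
      · refine le_trans (sum_le_sum fun b _ => ?_) (he j)
        simp only [Fin.snoc_castSucc]
        rcases hdb : d b with _ | k
        · have : Fin.last N ≠ j.castSucc := (Fin.castSucc_lt_last j).ne'
          by_cases hg : G a b <;> simp [hg, this]
        · simp [Fin.castSucc_inj]

-- Two-phase feedback codes.

/-- A two-phase feedback code: codewords `cw` decoded tentatively by `d` in the first phase, then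
a repeated letter, `xa` or `xr`, telling whether the tentative decision is right; the decision is
output if the outputs of the second phase lie in `A`, and erased otherwise. -/
def twoPhaseCode {X Y : Type*} {n₁ n₂ M : ℕ} (cw : Fin M → Fin n₁ → X)
    (d : (Fin n₁ → Y) → Fin M) (xa xr : X) (A : (Fin n₂ → Y) → Prop) [DecidablePred A] :
    ErasureCode X Y (n₁ + n₂) M where
  enc m t y := if h : (t : ℕ) < n₁ then cw m ⟨t, h⟩ else
    if d (fun i => y ⟨i, i.isLt.trans_le (not_lt.1 h)⟩) = m then xa else xr
  dec y := if A (fun i => y (Fin.natAdd n₁ i)) then some (d fun i => y (Fin.castAdd n₂ i)) else none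

section TwoPhase

variable {X Y : Type*} {n₁ n₂ M : ℕ} (cw : Fin M → Fin n₁ → X)
    (d : (Fin n₁ → Y) → Fin M) (xa xr : X) (A : (Fin n₂ → Y) → Prop) [DecidablePred A]
    (W : X → Y → ℝ)

theorem outProb_twoPhaseCode_append (m : Fin M) (y₁ : Fin n₁ → Y) (y₂ : Fin n₂ → Y) :
    (twoPhaseCode cw d xa xr A).outProb W m (Fin.append y₁ y₂) =
      (∏ t, W (cw m t) (y₁ t)) * ∏ t, W (if d y₁ = m then xa else xr) (y₂ t) := by
  rw [ErasureCode.outProb, Fin.prod_univ_add]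
  congr 1
  · refine prod_congr rfl fun t _ => ?_
    simp [twoPhaseCode]
  · refine prod_congr rfl fun t _ => ?_
    have : (fun i : Fin n₁ => Fin.append y₁ y₂ (Fin.castLE (Fin.natAdd n₁ t).isLt.le
        ⟨i, i.isLt.trans_le (by simp)⟩)) = y₁ := by
      funext i
      exact Fin.append_left y₁ y₂ i
    simp only [Fin.append_right]
    congr 1
    simp only [twoPhaseCode, Fin.val_natAdd, add_lt_iff_neg_left, not_lt_zero, dite_false, this]

variable [Fintype Y]

theorem sum_append (F : (Fin (n₁ + n₂) → Y) → ℝ) :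
    ∑ y, F y = ∑ y₁ : Fin n₁ → Y, ∑ y₂ : Fin n₂ → Y, F (Fin.append y₁ y₂) := by
  rw [← Fintype.sum_prod_type' (f := fun y₁ y₂ => F (Fin.append y₁ y₂))]
  exact (Fintype.sum_equiv (Fin.appendEquiv n₁ n₂) _ _ fun _ => rfl).symm

/-- The probability factors because after any wrong tentative decision the second-phase word is the
same, all `xr`. -/
theorem errProb_twoPhaseCode (m : Fin M) :
    (twoPhaseCode cw d xa xr A).errProb W m =
      (∑ y, if d y = m then 0 else ∏ t, W (cw m t) (y t)) *
        ∑ y, if A y then ∏ t, W xr (y t) else 0 := by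
  rw [ErasureCode.errProb, sum_append, sum_mul_sum]
  refine sum_congr rfl fun y₁ _ => sum_congr rfl fun y₂ _ => ?_
  rw [outProb_twoPhaseCode_append]
  by_cases h1 : d y₁ = m <;> by_cases h2 : A y₂ <;> simp [twoPhaseCode, h1, h2]

theorem erasureProb_twoPhaseCode_le (hW : ∀ x, W x ∈ stdSimplex ℝ Y) (m : Fin M) :
    (twoPhaseCode cw d xa xr A).erasureProb W m ≤
      (∑ y, if d y = m then 0 else ∏ t, W (cw m t) (y t)) +
        ∑ y, if A y then 0 else ∏ t, W xa (y t) := by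
  have hone : ∀ {k : ℕ} (x : Fin k → X), ∑ y : Fin k → Y, ∏ t, W (x t) (y t) = 1 := by
    intro k x
    have := (prod_univ_sum (fun _ : Fin k => (univ : Finset Y)) fun t y => W (x t) y).symm
    rw [Fintype.piFinset_univ] at this
    rw [this]
    exact prod_eq_one fun t _ => (hW (x t)).2
  have hnn : ∀ {k : ℕ} (x : Fin k → X) (y : Fin k → Y), 0 ≤ ∏ t, W (x t) (y t) :=
    fun x y => prod_nonneg fun t _ => (hW (x t)).1 _
  rw [ErasureCode.erasureProb, sum_append]
  calc _ ≤ ∑ y₁ : Fin n₁ → Y, ∑ y₂ : Fin n₂ → Y,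
        ((if d y₁ = m then 0 else ∏ t, W (cw m t) (y₁ t)) * ∏ t, W xr (y₂ t) +
          (∏ t, W (cw m t) (y₁ t)) * (if A y₂ then 0 else ∏ t, W xa (y₂ t))) := by
        refine sum_le_sum fun y₁ _ => sum_le_sum fun y₂ _ => ?_
        rw [outProb_twoPhaseCode_append]
        have a1 := hnn (cw m) y₁
        have a2 := hnn (fun _ => xr) y₂
        have a3 := hnn (fun _ => xa) y₂
        by_cases h1 : d y₁ = m <;> by_cases h2 : A y₂ <;> simp [twoPhaseCode, h1, h2] <;>
          positivity
    _ = _ := by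
        simp_rw [sum_add_distrib, ← mul_sum, ← sum_mul]
        rw [hone (cw m), hone fun _ => xr, mul_one, one_mul]

end TwoPhase

-- First phase: single-letter bounds and the special codeword.

theorem sum_prod_pi {ι Z : Type*} [Fintype ι] [DecidableEq ι] [Fintype Z] (g : ι → Z → ℝ) :
    ∑ z : ι → Z, ∏ t, g t (z t) = ∏ t, ∑ a, g t a := by
  rw [prod_univ_sum, Fintype.piFinset_univ]

/-- With `L = -ln λ`, transition and output probabilities all lie in `[exp (-L), 1]`, so `L` serves
as the constant `K` of `chernoff_lower`. -/
theorem abs_log_div_le {L a b : ℝ} (ha : Real.exp (-L) ≤ a) (ha1 : a ≤ 1)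
    (hb : Real.exp (-L) ≤ b) (hb1 : b ≤ 1) : |Real.log (a / b)| ≤ L := by
  have ha0 := (Real.exp_pos _).trans_le ha
  have hb0 := (Real.exp_pos _).trans_le hb
  have h1 := (Real.le_log_iff_exp_le ha0).2 ha
  have h2 := (Real.le_log_iff_exp_le hb0).2 hb
  have h3 := Real.log_nonpos ha0.le ha1
  have h4 := Real.log_nonpos hb0.le hb1
  rw [Real.log_div ha0.ne' hb0.ne', abs_le]
  constructor <;> linarith

theorem abs_sum_mul_le {Z : Type*} [Fintype Z] {p f : Z → ℝ} {L : ℝ} (hp0 : ∀ z, 0 ≤ p z)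
    (hp1 : ∑ z, p z = 1) (hf : ∀ z, |f z| ≤ L) : |∑ z, p z * f z| ≤ L := by
  calc |∑ z, p z * f z| ≤ ∑ z, |p z * f z| := abs_sum_le_sum_abs _ _
    _ ≤ ∑ z, p z * L := by
      refine sum_le_sum fun z _ => ?_
      rw [abs_mul, abs_of_nonneg (hp0 z)]
      exact mul_le_mul_of_nonneg_left (hf z) (hp0 z)
    _ = L := by rw [← sum_mul, hp1, one_mul]

theorem le_outDist {X Y : Type*} [Fintype X] {W : X → Y → ℝ} {l : ℝ} (hl : ∀ x y, l ≤ W x y)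
    {P : X → ℝ} (hP : P ∈ stdSimplex ℝ X) (y : Y) :
    l ≤ outDist P W y := by
  calc l = ∑ x, P x * l := by rw [← sum_mul, hP.2, one_mul]
    _ ≤ _ := sum_le_sum fun x _ => mul_le_mul_of_nonneg_left (hl x y) (hP.1 x)

theorem le_one_of_mem_stdSimplex {X : Type*} [Fintype X] {P : X → ℝ}
    (hP : P ∈ stdSimplex ℝ X) (x : X) : P x ≤ 1 :=
  hP.2 ▸ single_le_sum (fun x _ => hP.1 x) (mem_univ x)

section Channel

variable {X Y : Type*} [Fintype X] [Fintype Y] {W : X → Y → ℝ}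

theorem outDist_mem_stdSimplex (hW : ∀ x, W x ∈ stdSimplex ℝ Y) {P : X → ℝ}
    (hP : P ∈ stdSimplex ℝ X) : outDist P W ∈ stdSimplex ℝ Y := by
  refine ⟨fun y => sum_nonneg fun x _ => mul_nonneg (hP.1 x) ((hW x).1 y), ?_⟩
  simp_rw [outDist]
  rw [sum_comm]
  simp_rw [← mul_sum, (hW _).2, mul_one, hP.2]

theorem mutualInfo_eq_sum_prod (P : X → ℝ) (W : X → Y → ℝ) :
    mutualInfo P W =
      ∑ z : X × Y, P z.1 * W z.1 z.2 * Real.log (W z.1 z.2 / outDist P W z.2) := by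
  rw [Fintype.sum_prod_type]
  rfl

theorem sum_joint (hW : ∀ x, W x ∈ stdSimplex ℝ Y) {P : X → ℝ} (hP : P ∈ stdSimplex ℝ X) :
    ∑ z : X × Y, P z.1 * W z.1 z.2 = 1 := by
  rw [Fintype.sum_prod_type]
  simp_rw [← mul_sum, (hW _).2, mul_one, hP.2]

variable {L : ℝ} (hW : ∀ x, W x ∈ stdSimplex ℝ Y) (hL : ∀ x y, Real.exp (-L) ≤ W x y)

include hW hL

theorem abs_infoDensity_le {P : X → ℝ} (hP : P ∈ stdSimplex ℝ X) (x : X) (y : Y) :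
    |Real.log (W x y / outDist P W y)| ≤ L :=
  abs_log_div_le (hL x y) (le_one_of_mem_stdSimplex (hW x) y) (le_outDist hL hP y)
    (le_one_of_mem_stdSimplex (outDist_mem_stdSimplex hW hP) y)

theorem abs_log_outDist_div_le {P : X → ℝ} (hP : P ∈ stdSimplex ℝ X) (x : X) (y : Y) :
    |Real.log (outDist P W y / W x y)| ≤ L :=
  abs_log_div_le (le_outDist hL hP y)
    (le_one_of_mem_stdSimplex (outDist_mem_stdSimplex hW hP) y) (hL x y)
    (le_one_of_mem_stdSimplex (hW x) y)

theorem abs_mutualInfo_le {P : X → ℝ} (hP : P ∈ stdSimplex ℝ X) : |mutualInfo P W| ≤ L := by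
  rw [mutualInfo_eq_sum_prod]
  exact abs_sum_mul_le (fun z => mul_nonneg (hP.1 _) ((hW _).1 _)) (sum_joint hW hP)
    fun z => abs_infoDensity_le hW hL hP z.1 z.2

theorem abs_klDiv_outDist_le {P : X → ℝ} (hP : P ∈ stdSimplex ℝ X) (x : X) :
    |klDiv (outDist P W) (W x)| ≤ L :=
  abs_sum_mul_le (outDist_mem_stdSimplex hW hP).1 (outDist_mem_stdSimplex hW hP).2
    fun y => abs_log_outDist_div_le hW hL hP x y

/-- Codewords of length `n` with a special message `0`, whose codeword is `x₀`. The average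
mutual information governs the number of ordinary messages, and the average divergence of
the output distributions from the special codeword governs the error of the special message. -/
theorem exists_code_special_message {n : ℕ} (P : Fin n → X → ℝ)
    (hP : ∀ t, P t ∈ stdSimplex ℝ X) (x₀ : Fin n → X) {θ u τI τJ e : ℝ} (hθ : 0 ≤ θ)
    (hθL : θ * (2 * L) ≤ 1) (hI : τI ≤ ∑ t, mutualInfo (P t) W - u)
    (hJ : τJ ≤ ∑ t, klDiv (outDist (P t) W) (W (x₀ t)) - u) (N : ℕ)
    (hN : N * Real.exp (-τI) + 2 * Real.exp (-(θ * u) + n * (θ * (2 * L)) ^ 2) ≤ e) :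
    ∃ (cw : Fin (N + 1) → Fin n → X) (d : (Fin n → Y) → Fin (N + 1)),
      ∑ y, (if d y = 0 then 0 else ∏ t, W (cw 0 t) (y t)) ≤ Real.exp (-τJ) ∧
      ∀ m, m ≠ 0 → ∑ y, (if d y = m then 0 else ∏ t, W (cw m t) (y t)) ≤ e := by
  classical
  have hWpos : ∀ x y, 0 < W x y := fun x y => (Real.exp_pos _).trans_le (hL x y)
  have hQpos : ∀ t y, 0 < outDist (P t) W y := fun t y =>
    (Real.exp_pos _).trans_le (le_outDist hL (hP t) y)
  have hQ1 : ∀ t, ∑ y, outDist (P t) W y = 1 := fun t => (outDist_mem_stdSimplex hW (hP t)).2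
  have hq0 : ∀ a : Fin n → X, 0 ≤ ∏ t, P t (a t) := fun a => prod_nonneg fun t _ => (hP t).1 _
  have hV0 : ∀ (a : Fin n → X) (b : Fin n → Y), 0 ≤ ∏ t, W (a t) (b t) :=
    fun a b => prod_nonneg fun t _ => (hWpos _ _).le
  have hqV : ∀ b : Fin n → Y, ∑ a : Fin n → X, (∏ t, P t (a t)) * ∏ t, W (a t) (b t) =
      ∏ t, outDist (P t) W (b t) := by
    intro b
    simp_rw [← prod_mul_distrib]
    exact sum_prod_pi fun t x => P t x * W x (b t)
  have hc1 := chernoff_lower (fun t (z : X × Y) => P t z.1 * W z.1 z.2)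
    (fun t z => Real.log (W z.1 z.2 / outDist (P t) W z.2))
    (fun t z => mul_nonneg ((hP t).1 _) (hWpos _ _).le) (fun t => sum_joint hW (hP t))
    (K := L) (u := u) (fun t z => abs_infoDensity_le hW hL (hP t) z.1 z.2) hθ hθL
  have hc2 := chernoff_lower (fun t => outDist (P t) W)
    (fun t y => Real.log (outDist (P t) W y / W (x₀ t) y))
    (fun t y => (hQpos t y).le) hQ1
    (K := L) (u := u) (fun t y => abs_log_outDist_div_le hW hL (hP t) _ y) hθ hθL
  simp_rw [← mutualInfo_eq_sum_prod] at hc1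
  rw [Fintype.card_fin] at hc1 hc2
  obtain ⟨cw, d, hd, he⟩ := feinstein (fun a : Fin n → X => ∏ t, P t (a t))
    (fun (a : Fin n → X) (b : Fin n → Y) => ∏ t, W (a t) (b t)) hq0
    (by rw [sum_prod_pi]; exact prod_eq_one fun t _ => (hP t).2) hV0
    -- The first condition bounds the output mass of a region; the second keeps ordinary regions
    -- improbable under the special word.
    (fun a b => τI ≤ ∑ t, Real.log (W (a t) (b t) / outDist (P t) W (b t)) ∧
      τJ ≤ ∑ t, Real.log (outDist (P t) W (b t) / W (x₀ t) (b t)))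
    (Real.exp_pos (-τI)).le
    (by
      intro a
      refine le_trans (sum_le_sum fun b _ => ?_)
        (sum_llr_le (fun t => outDist (P t) W) (fun t => W (a t)) hQpos (fun t => hWpos _)
          (fun t => (hW _).2) τI)
      have h0 : 0 ≤ ∏ t, outDist (P t) W (b t) := prod_nonneg fun t _ => (hQpos t _).le
      rw [hqV]
      split_ifs with h1 h2 h2
      · exact le_rfl
      · exact absurd h1.1 h2
      · exact h0
      · exact le_rfl)
    (γ := 2 * Real.exp (-(θ * u) + n * (θ * (2 * L)) ^ 2))
    (by
      rw [two_mul]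
      refine le_trans ?_ (add_le_add hc1 hc2)
      have e1 : ∀ F : (Fin n → X) → (Fin n → Y) → ℝ,
          ∑ z : Fin n → X × Y, F (fun t => (z t).1) (fun t => (z t).2) = ∑ a, ∑ b, F a b := by
        intro F
        rw [← Fintype.sum_prod_type']
        exact Fintype.sum_equiv (Equiv.arrowProdEquivProdArrow _ _ _) _ _ fun _ => rfl
      rw [e1 fun a b => if ∑ t, Real.log (W (a t) (b t) / outDist (P t) W (b t)) <
        ∑ t, mutualInfo (P t) W - u then ∏ t, (P t (a t) * W (a t) (b t)) else 0]
      -- The second event involves the output only, so its probability is a marginal of the joint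
      -- law.
      have e2 : ∀ b : Fin n → Y, (if ∑ t, Real.log (outDist (P t) W (b t) / W (x₀ t) (b t)) <
          ∑ t, klDiv (outDist (P t) W) (W (x₀ t)) - u
          then ∏ t, outDist (P t) W (b t) else 0) =
          ∑ a : Fin n → X, if ∑ t, Real.log (outDist (P t) W (b t) / W (x₀ t) (b t)) <
          ∑ t, klDiv (outDist (P t) W) (W (x₀ t)) - u
          then ∏ t, (P t (a t) * W (a t) (b t)) else 0 := by
        intro b
        split_ifs
        · rw [← hqV]
          simp_rw [prod_mul_distrib]
        · simp
      calc _ ≤ ∑ a : Fin n → X, ∑ b : Fin n → Y,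
            ((if ∑ t, Real.log (W (a t) (b t) / outDist (P t) W (b t)) <
              ∑ t, mutualInfo (P t) W - u then ∏ t, (P t (a t) * W (a t) (b t)) else 0) +
            if ∑ t, Real.log (outDist (P t) W (b t) / W (x₀ t) (b t)) <
              ∑ t, klDiv (outDist (P t) W) (W (x₀ t)) - u
              then ∏ t, (P t (a t) * W (a t) (b t)) else 0) := by
            refine sum_le_sum fun a _ => ?_
            rw [mul_sum]
            refine sum_le_sum fun b _ => ?_
            have h0 : 0 ≤ ∏ t, (P t (a t) * W (a t) (b t)) :=
              prod_nonneg fun t _ => mul_nonneg ((hP t).1 _) (hWpos _ _).le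
            rw [mul_ite, mul_zero, ← prod_mul_distrib]
            split_ifs with h1 h2 h3 h3 h2 h3 h3 <;> try positivity
            · linarith
            · linarith
            · linarith
            · exact absurd ⟨hI.trans (not_lt.1 h2), hJ.trans (not_lt.1 h3)⟩ h1
        _ = _ := by
            simp_rw [sum_add_distrib]
            congr 1
            rw [sum_comm]
            exact sum_congr rfl fun b _ => (e2 b).symm)
    N hN
  -- Outputs in no ordinary region are decoded as the special message.
  refine ⟨Fin.cons x₀ cw, fun y => (d y).elim 0 Fin.succ, ?_, ?_⟩
  · refine le_trans (sum_le_sum fun y _ => ?_)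
      (sum_llr_le (fun t => W (x₀ t)) (fun t => outDist (P t) W) (fun t => hWpos _) hQpos hQ1 τJ)
    have h0 := hV0 x₀ y
    rcases hdy : d y with _ | i
    · simp only [hdy, Option.elim_none, if_true]
      split_ifs <;> simp [h0]
    · rw [if_pos (hd y i hdy).2]
      simp [hdy]
  · intro m hm
    obtain ⟨i, rfl⟩ := Fin.exists_succ_eq.2 hm
    refine le_trans (sum_le_sum fun y _ => ?_) (he i)
    rcases hdy : d y with _ | j
    · simp [hdy, (Fin.succ_ne_zero i).symm]
    · simp [hdy, Fin.succ_inj]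

end Channel

-- Second phase: the confirmation test.

/-- Binary hypothesis test between the constant input words `xa` and `xr`. -/
theorem exists_test {X Y : Type*} [Fintype Y] {W : X → Y → ℝ} {L : ℝ}
    (hW : ∀ x, W x ∈ stdSimplex ℝ Y) (hL : ∀ x y, Real.exp (-L) ≤ W x y) {n : ℕ} (xa xr : X)
    {θ u τ : ℝ} (hθ : 0 ≤ θ)
    (hθL : θ * (2 * L) ≤ 1) (hτ : τ ≤ n * klDiv (W xa) (W xr) - u) :
    ∃ A : (Fin n → Y) → Prop, ∃ _ : DecidablePred A,
      ∑ y, (if A y then ∏ t, W xr (y t) else 0) ≤ min 1 (Real.exp (-τ)) ∧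
      ∑ y, (if A y then 0 else ∏ t, W xa (y t)) ≤
        Real.exp (-(θ * u) + n * (θ * (2 * L)) ^ 2) := by
  classical
  have hWpos : ∀ x y, 0 < W x y := fun x y => (Real.exp_pos _).trans_le (hL x y)
  have hprod : ∀ x (y : Fin n → Y), 0 ≤ ∏ t, W x (y t) :=
    fun x y => prod_nonneg fun t _ => (hWpos _ _).le
  refine ⟨fun y => τ ≤ ∑ t, Real.log (W xa (y t) / W xr (y t)), inferInstance,
    le_min ?_ ?_, ?_⟩
  · calc _ ≤ ∑ y : Fin n → Y, ∏ t, W xr (y t) := by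
          refine sum_le_sum fun y _ => ?_
          split_ifs
          · exact le_rfl
          · exact hprod xr y
      _ = 1 := by
          rw [sum_prod_pi fun _ => W xr]
          exact prod_eq_one fun _ _ => (hW xr).2
  · exact sum_llr_le (fun _ => W xr) (fun _ => W xa) (fun _ => hWpos _) (fun _ => hWpos _)
      (fun _ => (hW _).2) τ
  · have hc := chernoff_lower (fun _ : Fin n => W xa)
      (fun _ y => Real.log (W xa y / W xr y)) (fun _ y => (hWpos _ y).le) (fun _ => (hW _).2)
      (K := L) (u := u) (fun _ y => abs_log_div_le (hL _ y) (le_one_of_mem_stdSimplex (hW _) y)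
        (hL _ y) (le_one_of_mem_stdSimplex (hW _) y)) hθ hθL
    rw [Fintype.card_fin] at hc
    refine le_trans (sum_le_sum fun y _ => ?_) hc
    rw [sum_const, card_univ, Fintype.card_fin, nsmul_eq_mul]
    have h0 := hprod xa y
    split_ifs with h1 h2 h2
    · exact h0
    · exact le_rfl
    · exact le_rfl
    · exact absurd (hτ.trans (not_lt.1 h2)) h1

-- Optimizing distributions and time sharing.

section Optimizers

variable {X Y : Type*} [Fintype X] [Fintype Y] {W : X → Y → ℝ}

theorem exists_mutualInfo_eq_capacity [Nonempty X] (hpos : ∀ x y, 0 < W x y) :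
    ∃ P ∈ stdSimplex ℝ X, mutualInfo P W = capacity W := by
  classical
  have hne : (stdSimplex ℝ X).Nonempty := ⟨_, single_mem_stdSimplex ℝ (Classical.arbitrary X)⟩
  have hout : ∀ P ∈ stdSimplex ℝ X, ∀ y, 0 < outDist P W y := by
    intro P hP y
    obtain ⟨x, hx⟩ := Finite.exists_min fun x => W x y
    have : W x y ≤ outDist P W y := by
      calc W x y = ∑ x', P x' * W x y := by rw [← sum_mul, hP.2, one_mul]
        _ ≤ _ := sum_le_sum fun x' _ => mul_le_mul_of_nonneg_left (hx x') (hP.1 x')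
    exact (hpos x y).trans_le this
  have hcont : ContinuousOn (fun P => mutualInfo P W) (stdSimplex ℝ X) := by
    unfold mutualInfo
    refine continuousOn_finsetSum _ fun x _ => continuousOn_finsetSum _ fun y _ => ?_
    refine ContinuousOn.mul (by fun_prop) (ContinuousOn.log (ContinuousOn.div (by fun_prop) ?_ ?_) ?_)
    · unfold outDist
      fun_prop
    · exact fun P hP => (hout P hP y).ne'
    · exact fun P hP => (div_pos (hpos x y) (hout P hP y)).ne'
  obtain ⟨P, hP, h⟩ := (isCompact_stdSimplex ℝ X).exists_sSup_image_eq hne hcont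
  exact ⟨P, hP, h.symm⟩

/-- Attainment of the supremum is not needed, since `δ` is absorbed in the error term. A
capacity-achieving distribution in both slots shows feasibility. -/
theorem exists_near_J [Nonempty X] (hpos : ∀ x y, 0 < W x y) {r δ : ℝ} (hr : r ≤ capacity W)
    (hδ : 0 < δ) :
    ∃ α ∈ Set.Icc (0 : ℝ) 1, ∃ x₁ x₂ : X,
      ∃ P₁ ∈ stdSimplex ℝ X, ∃ P₂ ∈ stdSimplex ℝ X,
        r ≤ α * mutualInfo P₁ W + (1 - α) * mutualInfo P₂ W ∧
        J W r - δ ≤ α * klDiv (outDist P₁ W) (W x₁) + (1 - α) * klDiv (outDist P₂ W) (W x₂) := by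
  obtain ⟨P, hP, hPC⟩ := exists_mutualInfo_eq_capacity hpos
  let x : X := Classical.arbitrary X
  obtain ⟨v, ⟨α, hα, x₁, x₂, P₁, hP₁, P₂, hP₂, hI, rfl⟩, hv⟩ :=
    exists_lt_of_lt_csSup (s := {v : ℝ | ∃ α ∈ Set.Icc (0 : ℝ) 1, ∃ x₁ x₂ : X,
      ∃ P₁ ∈ stdSimplex ℝ X, ∃ P₂ ∈ stdSimplex ℝ X,
      r ≤ α * mutualInfo P₁ W + (1 - α) * mutualInfo P₂ W ∧
      v = α * klDiv (outDist P₁ W) (W x₁) + (1 - α) * klDiv (outDist P₂ W) (W x₂)})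
      ⟨_, 1, by simp, x, x, P, hP, P, hP, by simpa [hPC] using hr, rfl⟩
      (sub_lt_self (J W r) hδ)
  exact ⟨α, hα, x₁, x₂, P₁, hP₁, P₂, hP₂, hI, hv.le⟩

end Optimizers

/-- Time sharing between two values over the first `⌊η n⌋` of `n` time units. -/
theorem le_sum_timeSharing {a₁ a₂ L α η : ℝ} (h₁ : |a₁| ≤ L) (h₂ : |a₂| ≤ L)
    (hα : α ∈ Set.Icc (0 : ℝ) 1)
    (hη : 0 ≤ η) (n : ℕ) :
    η * n * (α * a₁ + (1 - α) * a₂) - 3 * L ≤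
      ∑ t : Fin ⌊η * n⌋₊, if (t : ℕ) < ⌊α * ⌊η * n⌋₊⌋₊ then a₁ else a₂ := by
  obtain ⟨hα0, hα1⟩ := hα
  have hηn : 0 ≤ η * n := by positivity
  have b1 := Nat.floor_le hηn
  have b2 := Nat.lt_floor_add_one (η * n)
  generalize ⌊η * n⌋₊ = m at *
  have hαm : 0 ≤ α * m := by positivity
  have c1 := Nat.floor_le hαm
  have c2 := Nat.lt_floor_add_one (α * m)
  have c3 : ⌊α * m⌋₊ ≤ m := by
    refine Nat.floor_le_of_le ?_
    nlinarith [(Nat.cast_nonneg m : (0 : ℝ) ≤ m)]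
  generalize ⌊α * m⌋₊ = k at *
  obtain ⟨l, rfl⟩ := Nat.exists_eq_add_of_le c3
  have hsum : (∑ t : Fin (k + l), if (t : ℕ) < k then a₁ else a₂) = k * a₁ + l * a₂ := by
    rw [Fin.sum_univ_add]
    simp
  rw [hsum]
  push_cast at *
  rw [abs_le] at h₁ h₂
  have hv1 : α * a₁ + (1 - α) * a₂ ≤ L := by nlinarith
  have hv2 : -L ≤ α * a₁ + (1 - α) * a₂ := by nlinarith
  -- Rounding `η * n` costs at most `L`; rounding the switching time costs at most `2 * L`.
  have d1 : (η * n - (k + l)) * (α * a₁ + (1 - α) * a₂) ≤ L := by nlinarith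
  have d2 : (α * (k + l) - k) * (a₁ - a₂) ≤ 2 * L := by nlinarith
  linarith

end

-- Error term and degenerate code.

/-- Estimates on the error term in the range where it is less than one. -/
theorem error_term_estimates {L ε : ℝ} {n : ℕ} (hn : 1 ≤ n) (hL : 0 ≤ L) (hε1 : ε < 1)
    (hε : 40 * (1 + L) * √(Real.log (1 + n)) / √n ≤ ε) :
    0 < ε ∧ 3 * L ≤ n * ε / 8 ∧ Real.exp (-(n * ε / 2)) ≤ ε / 6 ∧
      Real.exp (-(n * ε ^ 2 / (256 * (1 + L) ^ 2))) ≤ ε / 6 := by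
  have hn1 : (1 : ℝ) ≤ n := by exact_mod_cast hn
  have hn0 : (0 : ℝ) < n := by linarith
  -- This turns `1600 * (1 + L) ^ 2 * log (1 + n) ≤ n * ε ^ 2` into `800 * (1 + L) ≤ n * ε ^ 2`,
  -- hence also a bound on `n * ε`.
  have hlog : 1 / 2 ≤ Real.log (1 + n) := by
    have h2 := Real.log_two_gt_d9
    have := Real.log_le_log (by norm_num : (0 : ℝ) < 2) (by linarith : (2 : ℝ) ≤ 1 + n)
    linarith
  have hl0 : 0 < Real.log (1 + n) := by linarith
  have hs0 : 0 < 40 * (1 + L) * √(Real.log (1 + n)) / √n := by positivity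
  have hε0 : 0 < ε := hs0.trans_le hε
  have hsq : 1600 * (1 + L) ^ 2 * Real.log (1 + n) ≤ n * ε ^ 2 := by
    have h := pow_le_pow_left₀ hs0.le hε 2
    rw [div_pow, mul_pow, mul_pow, Real.sq_sqrt hl0.le, Real.sq_sqrt hn0.le, div_le_iff₀ hn0] at h
    linarith
  have hL2 : (1 + L) ≤ (1 + L) ^ 2 := by nlinarith
  have hbig : 800 * (1 + L) ≤ n * ε ^ 2 := by nlinarith
  have hnε : n * ε ^ 2 ≤ n * ε := by nlinarith [mul_pos hn0 hε0]
  refine ⟨hε0, by linarith, ?_, ?_⟩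
  · have h1 := Real.add_one_le_exp (n * ε / 2)
    rw [Real.exp_neg, inv_le_comm₀ (Real.exp_pos _) (by positivity)]
    refine le_trans ?_ (le_trans (by linarith : n * ε / 2 ≤ _) h1)
    rw [inv_le_iff_one_le_mul₀ (by positivity)]
    nlinarith
  · have h1 : Real.log (1 + n) ≤ n * ε ^ 2 / (256 * (1 + L) ^ 2) := by
      rw [le_div_iff₀ (by positivity)]
      nlinarith [mul_pos hl0 (by positivity : 0 < (1 + L) ^ 2)]
    calc Real.exp (-(n * ε ^ 2 / (256 * (1 + L) ^ 2))) ≤ Real.exp (-Real.log (1 + n)) :=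
          Real.exp_le_exp.2 (neg_le_neg h1)
      _ = (1 + (n : ℝ))⁻¹ := by rw [Real.exp_neg, Real.exp_log (by linarith)]
      _ ≤ ε / 6 := by
        rw [inv_le_iff_one_le_mul₀ (by linarith)]
        nlinarith

/-- The code that erases every output sequence. -/
def erasingCode {X Y : Type*} (x : X) (n M : ℕ) : ErasureCode X Y n M where
  enc _ _ _ := x
  dec _ := none

theorem errProb_erasingCode {X Y : Type*} [Fintype Y] (W : X → Y → ℝ) (x : X) (n M : ℕ)
    (m : Fin M) : (erasingCode x n M : ErasureCode X Y n M).errProb W m = 0 := by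
  simp [ErasureCode.errProb, erasingCode]

theorem erasureProb_erasingCode {X Y : Type*} [Fintype Y] {W : X → Y → ℝ}
    (hW : ∀ x, W x ∈ stdSimplex ℝ Y) (x : X) (n M : ℕ)
    (m : Fin M) : (erasingCode x n M : ErasureCode X Y n M).erasureProb W m = 1 := by
  simp only [ErasureCode.erasureProb, erasingCode, ErasureCode.outProb, if_true]
  rw [sum_prod_pi fun _ => W x]
  exact Finset.prod_eq_one fun _ _ => (hW _).2

-- Assembly of the two phases.

/-- Two-phase codes with a fraction `η` of the block for the communication phase. -/
theorem exists_erasureCode {X Y : Type*} [Fintype X] [Fintype Y] [Nonempty X] {W : X → Y → ℝ}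
    (hW : ∀ x, W x ∈ stdSimplex ℝ Y) {L : ℝ} (hL0 : 0 ≤ L) (hL : ∀ x y, Real.exp (-L) ≤ W x y)
    {n : ℕ} {η r ε : ℝ} (hη0 : 0 ≤ η) (hη1 : η ≤ 1) (hr : r ≤ capacity W)
    (hε0 : 0 < ε) (hε1 : ε < 1) (h₁ : 3 * L ≤ n * ε / 8)
    (h₂ : Real.exp (-(n * ε / 2)) ≤ ε / 6)
    (h₃ : Real.exp (-(n * ε ^ 2 / (256 * (1 + L) ^ 2))) ≤ ε / 6) :
    ∃ (N : ℕ) (c : ErasureCode X Y n (N + 1)),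
      Real.exp (n * (η * r - ε)) ≤ N + 1 ∧
      c.errProb W 0 ≤ Real.exp (-(n * ((1 - η) * maxDiv W + η * J W r - ε))) ∧
      (∀ m, m ≠ 0 → c.errProb W m ≤ ε * min 1 (Real.exp (-(n * ((1 - η) * maxDiv W - ε))))) ∧
      ∀ m, c.erasureProb W m ≤ ε + Real.exp (-(n * (η * J W r - ε))) := by
  classical
  have hpos : ∀ x y, 0 < W x y := fun x y => (Real.exp_pos _).trans_le (hL x y)
  obtain ⟨α, hα, x₁, x₂, P₁, hP₁, P₂, hP₂, hI, hJ⟩ :=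
    exists_near_J hpos hr (by positivity : 0 < ε / 8)
  obtain ⟨⟨xa, xr⟩, hD⟩ : ∃ p : X × X, klDiv (W p.1) (W p.2) = maxDiv W :=
    exists_eq_ciSup_of_finite
  have hD0 : 0 ≤ maxDiv W := by
    have h := le_ciSup (Set.finite_range fun p : X × X => klDiv (W p.1) (W p.2)).bddAbove (xa, xa)
    refine le_trans (le_of_eq ?_) h
    simp [klDiv, (hpos _ _).ne']
  simp only at hD
  have hn0 : (0 : ℝ) ≤ n := Nat.cast_nonneg n
  have hts₁ := le_sum_timeSharing (abs_mutualInfo_le hW hL hP₁) (abs_mutualInfo_le hW hL hP₂)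
    hα hη0 n
  have hts₂ := le_sum_timeSharing (abs_klDiv_outDist_le hW hL hP₁ x₁)
    (abs_klDiv_outDist_le hW hL hP₂ x₂) hα hη0 n
  have hηn : η * n ≤ n := mul_le_of_le_one_left hn0 hη1
  have hηn0 : 0 ≤ η * n := by positivity
  have hfl := Nat.floor_le hηn0
  have hfln : ⌊η * n⌋₊ ≤ n := Nat.floor_le_of_le hηn
  generalize ⌊η * n⌋₊ = n₁ at *
  obtain ⟨n₂, rfl⟩ := Nat.exists_eq_add_of_le hfln
  push_cast at *
  set ν : ℝ := n₁ + n₂ with hν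
  set B := 1 + L with hB
  have hB1 : 1 ≤ B := by linarith
  -- Optimal for `u = ν * ε / 4`: the exponent `-θu + ν(2Bθ)²` becomes `-νε²/(256B²)`. Using `B = 1
  -- + L` avoids dividing by zero when `L = 0`.
  set θ := ε / (32 * B ^ 2) with hθdef
  have hθ : 0 ≤ θ := by positivity
  have hθB : θ * (2 * B) = ε / (16 * B) := by rw [hθdef]; field_simp; norm_num
  have hθL' : θ * (2 * L) ≤ θ * (2 * B) := mul_le_mul_of_nonneg_left (by linarith) hθ
  have hθL : θ * (2 * L) ≤ 1 := by
    refine hθL'.trans ?_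
    rw [hθB, div_le_one (by positivity)]
    linarith
  have hexp : ∀ m : ℕ, (m : ℝ) ≤ ν →
      Real.exp (-(θ * (ν * ε / 4)) + m * (θ * (2 * L)) ^ 2) ≤ ε / 6 := by
    intro m hm
    refine le_trans (Real.exp_le_exp.2 ?_) h₃
    calc -(θ * (ν * ε / 4)) + m * (θ * (2 * L)) ^ 2
        ≤ -(θ * (ν * ε / 4)) + ν * (θ * (2 * B)) ^ 2 := by
          have : (θ * (2 * L)) ^ 2 ≤ (θ * (2 * B)) ^ 2 :=
            pow_le_pow_left₀ (by positivity) hθL' 2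
          have : m * (θ * (2 * L)) ^ 2 ≤ ν * (θ * (2 * B)) ^ 2 :=
            mul_le_mul hm this (by positivity) hn0
          linarith
      _ = -(ν * ε ^ 2 / (256 * B ^ 2)) := by
          rw [hθB, hθdef]; field_simp; ring
  have hηr : η * ν * r ≤ η * ν * (α * mutualInfo P₁ W + (1 - α) * mutualInfo P₂ W) :=
    mul_le_mul_of_nonneg_left hI hηn0
  have hηJ := mul_le_mul_of_nonneg_left hJ hηn0
  have hηε : η * ν * (ε / 8) ≤ ν * (ε / 8) := mul_le_mul_of_nonneg_right hηn (by positivity)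
  set N := ⌊Real.exp (ν * (η * r - ε))⌋₊ with hN
  have hNle : (N : ℝ) ≤ Real.exp (ν * (η * r - ε)) := Nat.floor_le (Real.exp_pos _).le
  obtain ⟨cw, d, hd0, hd⟩ := exists_code_special_message hW hL
    (fun t : Fin n₁ => if (t : ℕ) < ⌊α * n₁⌋₊ then P₁ else P₂)
    (fun t => by split_ifs <;> assumption)
    (fun t : Fin n₁ => if (t : ℕ) < ⌊α * n₁⌋₊ then x₁ else x₂)
    -- The loss `ν * ε / 2` covers `ν * ε / 4` for the deviation and `ν * ε / 8` each for rounding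
    -- and for the approximation of `J`. The error `ε / 2` is `ε / 6` for the codeword count plus
    -- two Chernoff tails of `ε / 6`.
    (u := ν * ε / 4) (τI := ν * (η * r) - ν * ε / 2) (τJ := ν * (η * J W r) - ν * ε / 2)
    (e := ε / 2) hθ hθL
    (by
      have : ∀ t : Fin n₁, mutualInfo (if (t : ℕ) < ⌊α * n₁⌋₊ then P₁ else P₂) W =
          if (t : ℕ) < ⌊α * n₁⌋₊ then mutualInfo P₁ W else mutualInfo P₂ W :=
        fun t => by split_ifs <;> rfl
      simp_rw [this]
      linarith)
    (by
      have : ∀ t : Fin n₁, klDiv (outDist (if (t : ℕ) < ⌊α * n₁⌋₊ then P₁ else P₂) W)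
          (W (if (t : ℕ) < ⌊α * n₁⌋₊ then x₁ else x₂)) =
          if (t : ℕ) < ⌊α * n₁⌋₊ then klDiv (outDist P₁ W) (W x₁)
            else klDiv (outDist P₂ W) (W x₂) :=
        fun t => by split_ifs <;> rfl
      simp_rw [this]
      linarith)
    N
    (by
      have h4 : N * Real.exp (-(ν * (η * r) - ν * ε / 2)) ≤ Real.exp (-(ν * ε / 2)) := by
        refine (mul_le_mul_of_nonneg_right hNle (Real.exp_pos _).le).trans (le_of_eq ?_)
        rw [← Real.exp_add]
        congr 1
        ring
      linarith [hexp n₁ (by rw [hν]; linarith [(Nat.cast_nonneg n₂ : (0 : ℝ) ≤ n₂)])])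
  obtain ⟨A, hA, hAr, hAa⟩ := exists_test hW hL (n := n₂) xa xr (u := ν * ε / 4)
    (τ := ν * ((1 - η) * maxDiv W) - ν * ε / 2) hθ hθL
    (by
      rw [hD]
      -- The first phase was rounded down, so the second loses nothing.
      have : ν * (1 - η) ≤ n₂ := by linarith
      have := mul_le_mul_of_nonneg_right this hD0
      have : 0 ≤ ν * ε := by positivity
      linarith)
  have hAa' := hAa.trans (hexp n₂ (by rw [hν]; linarith [(Nat.cast_nonneg n₁ : (0 : ℝ) ≤ n₁)]))
  have hAr0 : 0 ≤ ∑ y : Fin n₂ → Y, (if A y then ∏ t, W xr (y t) else 0) :=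
    Finset.sum_nonneg fun y _ => by
      split_ifs
      · exact Finset.prod_nonneg fun t _ => (hpos _ _).le
      · exact le_rfl
  have hνε : 0 ≤ ν * ε := by positivity
  refine ⟨N, twoPhaseCode cw d xa xr A, (Nat.lt_floor_add_one _).le, ?_, ?_, ?_⟩
  -- The two phases each lose `ν * ε / 2` in the exponent.
  · rw [errProb_twoPhaseCode]
    refine (mul_le_mul hd0 (hAr.trans (min_le_right _ _)) hAr0 (Real.exp_pos _).le).trans
      (le_of_eq ?_)
    rw [← Real.exp_add]
    congr 1
    ring
  · intro m hm
    rw [errProb_twoPhaseCode]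
    refine mul_le_mul ((hd m hm).trans (by linarith)) (hAr.trans (min_le_min le_rfl ?_)) hAr0 hε0.le
    exact Real.exp_le_exp.2 (by linarith)
  · intro m
    refine (erasureProb_twoPhaseCode_le cw d xa xr A W hW m).trans ?_
    by_cases hm : m = 0
    · subst hm
      have : Real.exp (-(ν * (η * J W r) - ν * ε / 2)) ≤ Real.exp (-(ν * (η * J W r - ε))) :=
        Real.exp_le_exp.2 (by linarith)
      linarith
    · linarith [hd m hm, Real.exp_pos (-(ν * (η * J W r - ε)))]

end UEP

-- The theorem.

open UEP in
theorem lemma3 {X Y : Type*} [Fintype X] [Fintype Y]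
    (W : X → Y → ℝ) (hW : ∀ x, W x ∈ stdSimplex ℝ Y) (hpos : ∀ x y, 0 < W x y)
    (hC : 0 < UEP.capacity W)
    (n : ℕ) (hn : 1 ≤ n) (R E : ℝ)
    (hR0 : 0 ≤ R) (hRC : R ≤ UEP.capacity W)
    (hE0 : 0 ≤ E) (hED : E ≤ (1 - R / UEP.capacity W) * UEP.maxDiv W) :
    ∃ (M : ℕ) (_ : NeZero M) (c : UEP.ErasureCode X Y n M),
      Real.exp (n * (R - UEP.epsTerm W n)) ≤ (M : ℝ) ∧
      c.errProb W 0 ≤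
        Real.exp (-(n * (E + (1 - E / UEP.maxDiv W) * UEP.J W (R / (1 - E / UEP.maxDiv W))
          - UEP.epsTerm W n))) ∧
      (∀ m : Fin M, m ≠ 0 →
        c.errProb W m ≤
          UEP.epsTerm W n * min 1 (Real.exp (-(n * (E - UEP.epsTerm W n))))) ∧
      (∀ m : Fin M,
        c.erasureProb W m ≤
          UEP.epsTerm W n +
            Real.exp (-(n * ((1 - E / UEP.maxDiv W) * UEP.J W (R / (1 - E / UEP.maxDiv W))
              - UEP.epsTerm W n)))) := by
  have hXne : Nonempty X := by
    by_contra h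
    rw [not_nonempty_iff] at h
    have : stdSimplex ℝ X = ∅ := by
      ext P
      simp [stdSimplex]
    simp [capacity, this] at hC
  obtain ⟨x₀⟩ := id hXne
  -- If the error term is at least 1, erasing everything meets all the bounds.
  rcases le_or_gt 1 (epsTerm W n) with hε1 | hε1
  · refine ⟨⌊Real.exp (n * (R - epsTerm W n))⌋₊ + 1, inferInstance, erasingCode x₀ n _,
      ?_, ?_, ?_, ?_⟩
    · push_cast
      exact (Nat.lt_floor_add_one _).le
    · rw [errProb_erasingCode]
      positivity
    · intro m _
      rw [errProb_erasingCode]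
      positivity
    · intro m
      rw [erasureProb_erasingCode hW]
      exact hε1.trans (le_add_of_nonneg_right (Real.exp_pos _).le)
  have hYne : Nonempty Y := by
    by_contra h
    rw [not_nonempty_iff] at h
    simpa using (hW x₀).2
  -- Positive capacity forces two letters in each alphabet, whence the constant `40 = 10 * 2 * 2`.
  have hX2 : 2 ≤ Fintype.card X := by
    by_contra! hX
    have hsub : Subsingleton X := Fintype.card_le_one_iff_subsingleton.1 (by omega)
    have huniv : (Finset.univ : Finset X) = {x₀} := by
      ext x; simp [Subsingleton.elim x x₀]
    obtain ⟨P, hP, hPC⟩ := exists_mutualInfo_eq_capacity hpos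
    have hP1 : P x₀ = 1 := by simpa [huniv] using hP.2
    have : mutualInfo P W = 0 := by
      simp [mutualInfo, outDist, huniv, hP1, (hpos _ _).ne']
    linarith
  have hY2 : 2 ≤ Fintype.card Y := by
    by_contra! hY
    have hsub : Subsingleton Y := Fintype.card_le_one_iff_subsingleton.1 (by omega)
    obtain ⟨y₀⟩ := hYne
    have huniv : (Finset.univ : Finset Y) = {y₀} := by
      ext y; simp [Subsingleton.elim y y₀]
    obtain ⟨P, hP, hPC⟩ := exists_mutualInfo_eq_capacity hpos
    have hW1 : ∀ x, W x y₀ = 1 := fun x => by simpa [huniv] using (hW x).2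
    have : mutualInfo P W = 0 := by
      simp [mutualInfo, outDist, huniv, hW1, hP.2]
    linarith
  have hmin_le : ∀ x y, minTrans W ≤ W x y := fun x y =>
    ciInf_le (Set.finite_range fun p : X × Y => W p.1 p.2).bddBelow (x, y)
  obtain ⟨⟨xm, ym⟩, hm⟩ : ∃ p : X × Y, W p.1 p.2 = minTrans W := exists_eq_ciInf_of_finite
  have hmin0 : 0 < minTrans W := hm ▸ hpos xm ym
  have hmin1 : minTrans W ≤ 1 := hm ▸ le_one_of_mem_stdSimplex (hW xm) ym
  obtain ⟨L, hLdef⟩ : ∃ L, L = -Real.log (minTrans W) := ⟨_, rfl⟩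
  have hL0 : 0 ≤ L := by
    have := Real.log_nonpos hmin0.le hmin1
    linarith
  have hL : ∀ x y, Real.exp (-L) ≤ W x y := by
    intro x y
    rw [hLdef, neg_neg, Real.exp_log hmin0]
    exact hmin_le x y
  have hεL : 40 * (1 + L) * √(Real.log (1 + n)) / √n ≤ epsTerm W n := by
    have hlog : Real.log (Real.exp 1 / minTrans W) = 1 + L := by
      rw [Real.log_div (Real.exp_pos _).ne' hmin0.ne', Real.log_exp, hLdef]
      ring
    rw [epsTerm, hlog]
    have hX2' : (2 : ℝ) ≤ Fintype.card X := by exact_mod_cast hX2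
    have hY2' : (2 : ℝ) ≤ Fintype.card Y := by exact_mod_cast hY2
    gcongr
    nlinarith
  obtain ⟨hε0, h₁, h₂, h₃⟩ := error_term_estimates hn hL0 hε1 hεL
  have hD0 : 0 ≤ maxDiv W := by
    have h := le_ciSup (Set.finite_range fun p : X × X => klDiv (W p.1) (W p.2)).bddAbove (x₀, x₀)
    refine le_trans (le_of_eq ?_) h
    simp [klDiv, (hpos _ _).ne']
  have hRC1 : 0 ≤ R / capacity W := by positivity
  -- Only `D ≥ 0` is at hand; if `D = 0` then `E = 0`, and `E / 0 = 0` keeps the identity true.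
  have hDE : E / maxDiv W * maxDiv W = E := by
    rcases hD0.eq_or_lt with h | h
    · rw [← h] at hED ⊢
      linarith
    · exact div_mul_cancel₀ E h.ne'
  have hη1 : 0 ≤ E / maxDiv W := div_nonneg hE0 hD0
  have hη : R / capacity W ≤ 1 - E / maxDiv W := by
    rcases hD0.eq_or_lt with h | h
    · rw [← h, div_zero, sub_zero]
      exact div_le_one_of_le₀ hRC hC.le
    · have := (div_le_iff₀ h).2 hED
      linarith
  generalize E / maxDiv W = ξ at *
  -- If `ξ = 1` then `R = 0`, and `R / 0 = 0` matches the convention for `E = D`.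
  have hR : (1 - ξ) * (R / (1 - ξ)) = R := by
    rcases (hRC1.trans hη).eq_or_lt with h | h
    · have : R = 0 := by
        have h0 : R / capacity W = 0 := le_antisymm (h ▸ hη) hRC1
        simpa [hC.ne'] using h0
      simp [this]
    · exact mul_div_cancel₀ R h.ne'
  have hr : R / (1 - ξ) ≤ capacity W := by
    refine div_le_of_le_mul₀ (hRC1.trans hη) hC.le ?_
    rw [div_le_iff₀ hC] at hη
    linarith
  obtain ⟨N, c, hc₁, hc₂, hc₃, hc₄⟩ := exists_erasureCode hW hL0 hL (n := n) (η := 1 - ξ)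
    (hRC1.trans hη) (by linarith) hr hε0 hε1 h₁ h₂ h₃
  rw [sub_sub_cancel, hDE] at hc₂ hc₃
  rw [hR] at hc₁
  exact ⟨N + 1, inferInstance, c, by exact_mod_cast hc₁, hc₂, hc₃, hc₄⟩
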